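/- **Setting.** Let $d,m,H\in\mathbb N$. Given $a,\tau\in\mathbb R^d$, $T\in\mathbb R$, $G_1,\dots,G_m\in\mathbb R^{d\times d}$ and $B_0,\dots,B_{H-1}\in\mathbb R^{d\times m}$, let $$F_k(z,v)=E_P(v)\bigl(E_D z+\bar B_k v\bigr),\qquad E_P(v)=\exp\Bigl(T\sum_{j=1}^m v_jG_j\Bigr),\qquad E_D=\operatorname{diag}\bigl(e^{a_n\tau_n}\bigr),\qquad (\bar B_k)_{nj}=\frac{e^{a_n\tau_n}-1}{a_n}(B_k)_{nj}$$ (the factor is $\tau_n$ if $a_n=0$). The maps $F_k$ are smooth, so their Jacobians are locally Lipschitz. For a fixed initial state $\hat z$, a fixed previous input $u_{-1}\in\mathbb R^m$ and bounds $u_{\min},u_{\max}\in\mathbb R^m$, with $\mathcal U=\{v\in\mathbb R^m: u_{\min}\le v\le u_{\max}\}$, consider the bilinear MPC problem $$\min_{z,u}\ \Phi(z,u)=\sum_{k=0}^{H-1}\bigl(\ell_k(z_k,u_k)+\rho_k(u_k-u_{k-1})\bigr)+\ell_H(z_H)\quad\text{s.t. } z_0=\hat z,\ z_{k+1}=F_k(z_k,u_k),\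 u_k\in\mathcal U\quad(0\le k<H),$$ where all $\ell_k,\rho_k,\ell_H$ are convex quadratic functions. Call $u=(u_0,\dots,u_{H-1})$ admissible if $u_k\in\mathcal U$ for all $k$; let $z(u)$ be the trajectory generated by $u$ and $J(u)=\Phi(z(u),u)$. For nominal controls $\bar u$ with $\bar z=z(\bar u)$ put $J_{\rm lin}(\delta u;\bar u)=\Phi(\bar z+\delta z,\bar u+\delta u)$, where $\delta z_0=0$ and $\delta z_{k+1}=\partial_zF_k(\bar z_k,\bar u_k)\delta z_k+\partial_uF_k(\bar z_k,\bar u_k)\delta u_k$. The subproblem at $\bar u$ with radius $\varepsilon$ is to minimize $J_{\rm lin}(\delta u;\bar u)$ subject to $\bar u_k+\delta u_k\in\mathcal U$ and $\|\delta u_k\|_\infty\le\varepsilon$ for all $k$; the predicted decrease of a solution $\delta u$ is $\Delta=J_{\rm lin}(0;\bar u)-J_{\rm lin}(\delta u;\bar u)$. A run of trust-region SCP with acceptance threshold $\eta\in[0,1)$ starts with an admissible $\bar u^{(0)}$ and a radius $\varepsilon^{(0)}>0$ and never stops. In iteration $n$ it takes a solution $\delta u^{(n)}$, with predicted decrease $\Delta^{(n)}$,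 of the subproblem at $\bar u^{(n)}$ with radius $\varepsilon^{(n)}$. If $J(\bar u^{(n)})-J(\bar u^{(n)}+\delta u^{(n)})\ge\eta\,\Delta^{(n)}$, the step is accepted: $\bar u^{(n+1)}=\bar u^{(n)}+\delta u^{(n)}$, $\varepsilon^{(n+1)}=\varepsilon^{(n)}$. Otherwise $\bar u^{(n+1)}=\bar u^{(n)}$, $\varepsilon^{(n+1)}=\varepsilon^{(n)}/2$. (For $\eta=0$ the test is $J(\bar u^{(n)}+\delta u^{(n)})\le J(\bar u^{(n)})$.) Put $\bar z^{(n)}=z(\bar u^{(n)})$. A pair $(z,u)$ is a KKT point if it is feasible for the MPC problem and there are multipliers $\lambda_k\in\mathbb R^d$ of the dynamics constraints and $\mu^-_k,\mu^+_k\in\mathbb R^m_{\ge0}$ of the bounds, satisfying complementary slackness, for which the derivative of the Lagrangian $\Phi(z,u)+\sum_k\lambda_k^\top(F_k(z_k,u_k)-z_{k+1})+\sum_k(\mu_k^-)^\top(u_{\min}-u_k)+\sum_k(\mu_k^+)^\top(u_k-u_{\max})$ with respect to $z_1,\dots,z_H,u_0,\dots,u_{H-1}$ vanishes. **Proposition.**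 (i) *Monotone descent.* * For every bounded set $S$ of control sequences and every $\varepsilon_{\max}$ there is $C$ such that $|J_{\rm lin}(\delta u;\bar u)-J(\bar u+\delta u)|\le C\varepsilon^2$ for all $\bar u\in S$, $0<\varepsilon\le\varepsilon_{\max}$ and all $\delta u$ with $\|\delta u_k\|_\infty\le\varepsilon$ for all $k$. * At admissible $\bar u$, each subproblem with radius $\varepsilon>0$ has a solution. * If a solution $\delta u$ of a subproblem at $\bar u$ satisfies $|J_{\rm lin}(\delta u;\bar u)-J(\bar u+\delta u)|<\Delta$, then $J(\bar u+\delta u)<J(\bar u)$. If $\bar u$ is admissible and the predicted decrease at $\bar u$ is positive for some radius $\varepsilon>0$, then there is $\varepsilon_1>0$ such that this condition holds for all radii $0<\varepsilon\le\varepsilon_1$ and all solutions of the subproblem. * In every run, whenever $\Delta^{(n)}>0$, a step is accepted after finitely many (possibly no) halvings of the radius following iteration $n$; and the sequence $J(\bar u^{(n)})$ is non-increasing. (ii) *KKT convergence.* * For admissible $\bar u$, $\varepsilon>0$ and a solution of the subproblem, the predicted decrease is zero if and only if $(z(\bar u),\bar u)$ is a KKT point. * In every run, let $(z^\star,u^\star)$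 be an accumulation point of the sequence $(\bar z^{(n)},\bar u^{(n)})$, and suppose that $\eta>0$ or, if $\eta=0$, that sufficient decrease holds near $u^\star$: there are $\kappa>0$ and a neighbourhood $N$ of $u^\star$ such that all but finitely many of the accepted steps with $\bar u^{(n)}\in N$ satisfy $J(\bar u^{(n)})-J(\bar u^{(n)}+\delta u^{(n)})\ge\kappa\,\Delta^{(n)}$. Then $(z^\star,u^\star)$ is a KKT point. No further constraint qualification is needed. -/

import Mathlib

open Filter Topology

/-- `f` is a convex quadratic function `x ↦ Q(x, x) + b x + c` with `Q` positive semidefinite. -/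
def IsConvexQuadratic {E : Type*} [AddCommGroup E] [Module ℝ E] (f : E → ℝ) : Prop :=
  ∃ (Q : LinearMap.BilinForm ℝ E) (b : E →ₗ[ℝ] ℝ) (c : ℝ),
    (∀ x, 0 ≤ Q x x) ∧ ∀ x, f x = Q x x + b x + c

/-- Parameters of the bilinear latent model with latent dimension `d`, input dimension `m` and
horizon `H`. -/
structure BilinearModel (d m H : ℕ) where
  /-- diagonal continuous-time eigenvalues -/
  a : Fin d → ℝ
  /-- per-mode timescales -/
  tau : Fin d → ℝ
  /-- scalar sampling period -/
  T : ℝ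
  /-- control-state coupling matrices, one per input channel -/
  G : Fin m → Matrix (Fin d) (Fin d) ℝ
  /-- step-varying continuous-time actuator matrices -/
  B : Fin H → Matrix (Fin d) (Fin m) ℝ

namespace BilinearModel

variable {d m H : ℕ}

/-- `E_P(v) = exp (T • ∑ j, v j • G j)`, the matrix exponential of the coupling part. -/
noncomputable def expP (M : BilinearModel d m H) (v : Fin m → ℝ) : Matrix (Fin d) (Fin d) ℝ :=
  NormedSpace.exp (M.T • ∑ j, v j • M.G j)

/-- `E_D = diag (exp (a n * tau n))`. -/
noncomputable def expD (M : BilinearModel d m H) : Matrix (Fin d) (Fin d) ℝ :=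
  Matrix.diagonal fun n => Real.exp (M.a n * M.tau n)

/-- The diagonal zero-order-hold input matrix: row `n` of `B k` is multiplied by the integral of
`exp (a n * s)` over `0 ≤ s ≤ tau n`, which is `(exp (a n * tau n) - 1) / a n`, with the value
`tau n` if `a n = 0`. -/
noncomputable def Bbar (M : BilinearModel d m H) (k : Fin H) : Matrix (Fin d) (Fin m) ℝ :=
  Matrix.of fun n j =>
    (if M.a n = 0 then M.tau n else (Real.exp (M.a n * M.tau n) - 1) / M.a n) * M.B k n j

/-- The Lie-Trotter one-step map `F_LT(z, v) = E_P(v) (E_D z + Bbar_k v)`. -/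
noncomputable def F (M : BilinearModel d m H) (k : Fin H) (z : Fin d → ℝ) (v : Fin m → ℝ) :
    Fin d → ℝ :=
  (M.expP v).mulVec (M.expD.mulVec z + (M.Bbar k).mulVec v)

/-- State Jacobian of the one-step map. -/
noncomputable def Ajac (M : BilinearModel d m H) (k : Fin H) (z : Fin d → ℝ) (v : Fin m → ℝ) :
    (Fin d → ℝ) →L[ℝ] (Fin d → ℝ) :=
  fderiv ℝ (fun z' => M.F k z' v) z

/-- Input Jacobian of the one-step map. -/
noncomputable def Bjac (M : BilinearModel d m H) (k : Fin H) (z : Fin d → ℝ) (v : Fin m → ℝ) :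
    (Fin m → ℝ) →L[ℝ] (Fin d → ℝ) :=
  fderiv ℝ (fun v' => M.F k z v') v

end BilinearModel

/-- Data of the open-loop bilinear MPC problem. The objective consists of stage costs in
`(z_k, u_k)`, control-increment penalties in `u_k - u_{k-1}` (with the previously applied input
`u_{-1} = uPrev` as fixed data; take them to be `0` if they are not used) and a terminal cost in
`z_H`, all convex quadratic. The admissible set is the box `[umin, umax]`. -/
structure BilinearMPC (d m H : ℕ) where
  model : BilinearModel d m H
  z0 : Fin d → ℝ
  umin : Fin m → ℝ
  umax : Fin m → ℝ
  uPrev : Fin m → ℝ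
  stage : Fin H → (Fin d → ℝ) × (Fin m → ℝ) → ℝ
  increment : Fin H → (Fin m → ℝ) → ℝ
  terminal : (Fin d → ℝ) → ℝ
  stage_quadratic : ∀ k, IsConvexQuadratic (stage k)
  increment_quadratic : ∀ k, IsConvexQuadratic (increment k)
  terminal_quadratic : IsConvexQuadratic terminal

namespace BilinearMPC

variable {d m H : ℕ}

/-- The objective as a function of a state trajectory `z_0, …, z_H` and controls
`u_0, …, u_{H-1}`. -/
noncomputable def cost (P : BilinearMPC d m H) (z : Fin (H + 1) → Fin d → ℝ)
    (u : Fin H → Fin m → ℝ) : ℝ :=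
  (∑ k : Fin H, (P.stage k (z k.castSucc, u k) +
      P.increment k (u k - (Fin.cons P.uPrev u : Fin (H + 1) → Fin m → ℝ) k.castSucc))) +
    P.terminal (z (Fin.last H))

/-- The trajectory `z_0, …, z_H` generated by the controls `u` under the nonlinear dynamics. -/
noncomputable def rollout (P : BilinearMPC d m H) (u : Fin H → Fin m → ℝ) :
    Fin (H + 1) → Fin d → ℝ :=
  Fin.induction (motive := fun _ => Fin d → ℝ) P.z0 (fun k zk => P.model.F k zk (u k))

/-- The state deviation `δz_0, …, δz_H` generated by `δu` under the dynamics linearized at the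
nominal trajectory of `ubar`. -/
noncomputable def linRollout (P : BilinearMPC d m H) (ubar du : Fin H → Fin m → ℝ) :
    Fin (H + 1) → Fin d → ℝ :=
  Fin.induction (motive := fun _ => Fin d → ℝ) 0 (fun k dzk =>
    P.model.Ajac k (P.rollout ubar k.castSucc) (ubar k) dzk +
      P.model.Bjac k (P.rollout ubar k.castSucc) (ubar k) (du k))

/-- The true cost of a control sequence. -/
noncomputable def J (P : BilinearMPC d m H) (u : Fin H → Fin m → ℝ) : ℝ :=
  P.cost (P.rollout u) u

/-- The objective evaluated on the linearized trajectory. -/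
noncomputable def Jlin (P : BilinearMPC d m H) (ubar du : Fin H → Fin m → ℝ) : ℝ :=
  P.cost (P.rollout ubar + P.linRollout ubar du) (ubar + du)

/-- Every control lies in the box. -/
def Admissible (P : BilinearMPC d m H) (u : Fin H → Fin m → ℝ) : Prop :=
  ∀ k, u k ∈ Set.Icc P.umin P.umax

/-- Feasible set of the convex subproblem at `ubar` with trust-region radius `ε`
(the norm on `Fin m → ℝ` is the sup norm). -/
def subFeasible (P : BilinearMPC d m H) (ubar : Fin H → Fin m → ℝ) (ε : ℝ) :
    Set (Fin H → Fin m → ℝ) :=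
  {du | P.Admissible (ubar + du) ∧ ∀ k, ‖du k‖ ≤ ε}

/-- `du` solves the convex subproblem at `ubar` with trust-region radius `ε`. -/
def IsSubSolution (P : BilinearMPC d m H) (ubar : Fin H → Fin m → ℝ) (ε : ℝ)
    (du : Fin H → Fin m → ℝ) : Prop :=
  du ∈ P.subFeasible ubar ε ∧ ∀ dv ∈ P.subFeasible ubar ε, P.Jlin ubar du ≤ P.Jlin ubar dv

/-- Predicted cost decrease of the step `du`. -/
noncomputable def pred (P : BilinearMPC d m H) (ubar du : Fin H → Fin m → ℝ) : ℝ :=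
  P.Jlin ubar 0 - P.Jlin ubar du

/-- Acceptance test with threshold `η`: the actual decrease is at least `η` times the predicted
one. For `η = 0` this is the simple test `J (ubar + du) ≤ J ubar`. -/
def Accepts (P : BilinearMPC d m H) (η : ℝ) (ubar du : Fin H → Fin m → ℝ) : Prop :=
  η * P.pred ubar du ≤ P.J ubar - P.J (ubar + du)

/-- A run (with an unlimited number of iterations) of trust-region SCP with acceptance threshold
`η`: in iteration `n` the nominal controls are `u n`, the radius is `ε n`, and `du n` is a solution
of the convex subproblem. Accepted steps are taken with the radius unchanged; otherwise the
nominal controls are kept and the radius is halved. -/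
structure IsSCPRun (P : BilinearMPC d m H) (η : ℝ) (u : ℕ → Fin H → Fin m → ℝ) (ε : ℕ → ℝ)
    (du : ℕ → Fin H → Fin m → ℝ) : Prop where
  init_admissible : P.Admissible (u 0)
  init_radius : 0 < ε 0
  solves : ∀ n, P.IsSubSolution (u n) (ε n) (du n)
  accept : ∀ n, P.Accepts η (u n) (du n) → u (n + 1) = u n + du n ∧ ε (n + 1) = ε n
  reject : ∀ n, ¬ P.Accepts η (u n) (du n) → u (n + 1) = u n ∧ ε (n + 1) = ε n / 2

/-- Sufficient decrease near `ustar`: for some `κ > 0`, all but finitely many of the accepted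
steps that start in some neighbourhood of `ustar` achieve at least the fraction `κ` of their
predicted decrease. -/
def SufficientDecreaseAt (P : BilinearMPC d m H) (η : ℝ) (u du : ℕ → Fin H → Fin m → ℝ)
    (ustar : Fin H → Fin m → ℝ) : Prop :=
  ∃ κ : ℝ, 0 < κ ∧ ∃ N ∈ 𝓝 ustar, ∀ᶠ n in atTop, u n ∈ N → P.Accepts η (u n) (du n) →
    κ * P.pred (u n) (du n) ≤ P.J (u n) - P.J (u n + du n)

/-- `(z, u)` is a Karush-Kuhn-Tucker point of the nonlinear problem of minimizing `cost z u`
subject to `z_{k+1} = F_k(z_k, u_k)`, with `z_0` fixed, and `umin ≤ u_k ≤ umax`: it is feasible,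
and there are multipliers `lam` for the dynamics and nonnegative, complementary multipliers
`mlo`, `mhi` for the bounds such that the derivative of the Lagrangian vanishes in all
directions `(dz, dv)`, where `dz_0 = 0` as `z_0` is not a variable. -/
def IsKKT (P : BilinearMPC d m H) (z : Fin (H + 1) → Fin d → ℝ) (u : Fin H → Fin m → ℝ) : Prop :=
  z 0 = P.z0 ∧ (∀ k : Fin H, z k.succ = P.model.F k (z k.castSucc) (u k)) ∧ P.Admissible u ∧
  ∃ (lam : Fin H → Fin d → ℝ) (mlo mhi : Fin H → Fin m → ℝ),
    (∀ k j, 0 ≤ mlo k j) ∧ (∀ k j, 0 ≤ mhi k j) ∧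
    (∀ k j, mlo k j * (P.umin j - u k j) = 0) ∧
    (∀ k j, mhi k j * (u k j - P.umax j) = 0) ∧
    ∀ (dz : Fin (H + 1) → Fin d → ℝ) (dv : Fin H → Fin m → ℝ), dz 0 = 0 →
      fderiv ℝ (fun p : (Fin (H + 1) → Fin d → ℝ) × (Fin H → Fin m → ℝ) => P.cost p.1 p.2)
          (z, u) (dz, dv)
        + (∑ k : Fin H, lam k ⬝ᵥ (P.model.Ajac k (z k.castSucc) (u k) (dz k.castSucc)
            + P.model.Bjac k (z k.castSucc) (u k) (dv k) - dz k.succ))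
        + (∑ k : Fin H, (mhi k - mlo k) ⬝ᵥ dv k) = 0

end BilinearMPC

/-!
The controls-to-trajectory map `rollout` is smooth, and its derivative is the linearized trajectory.
Hence the linearized cost `Jlin u` is the composition of the convex, smooth objective with the first
order expansion of `rollout` at `u`: it is convex in the step, and by Taylor's formula it differs
from the true cost by `O(‖du‖²)`, uniformly on bounded sets (`exists_model_error_bound`).

By convexity, the predicted decrease vanishes if and only if the derivative of `Jlin u` at zero
(which is also the derivative of the true cost) is nonnegative in all feasible directions
(`IsSubSolution.pred_eq_zero_iff`). This is equivalent to the KKT conditions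
(`isKKT_rollout_iff`): multipliers of the box are the positive and negative parts of that
derivative, and multipliers of the dynamics exist because a functional vanishing on the kernel of
the linearized dynamics factors through them.

If some step promises a decrease at `ustar`, then convexity makes the predicted decrease at all
nearby controls at least linear in the radius, so that it dominates the quadratic model error once
the radius is small (`exists_eventually_mul_min_le_pred`, `exists_eventually_model_error_lt`). This
gives descent and acceptance after finitely many halvings. It also excludes a non-stationary
accumulation point (`IsSCPRun.isKKT_of_mapClusterPt`): an accepted step nearby lowers the cost in
proportion to the radius, so the radii must tend to zero; but then all steps nearby are accepted
with a decrease proportional to their length, which traps the iterates near the accumulation point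
as the cost converges, and the radius no longer changes.
-/

/-! ### Convex quadratic functions and differentiable maps -/

section Analysis

variable {E F : Type*} [NormedAddCommGroup E] [NormedSpace ℝ E] [NormedAddCommGroup F]
  [NormedSpace ℝ F]

theorem IsConvexQuadratic.convexOn {V : Type*} [AddCommGroup V] [Module ℝ V] {f : V → ℝ}
    (hf : IsConvexQuadratic f) : ConvexOn ℝ Set.univ f := by
  obtain ⟨Q, b, c, hQ, hf⟩ := hf
  refine ⟨convex_univ, fun x _ y _ s t hs ht hst => ?_⟩
  have h := mul_nonneg (mul_nonneg hs ht) (hQ (x - y))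
  obtain rfl : t = 1 - s := by linarith
  simp only [hf, map_sub, map_add, map_smul, LinearMap.sub_apply, LinearMap.add_apply,
    LinearMap.smul_apply, smul_eq_mul] at h ⊢
  linarith

theorem IsConvexQuadratic.contDiff [FiniteDimensional ℝ E] {f : E → ℝ}
    (hf : IsConvexQuadratic f) {n : WithTop ℕ∞} : ContDiff ℝ n f := by
  obtain ⟨Q, b, c, -, hf⟩ := hf
  let Q' : E →L[ℝ] E →L[ℝ] ℝ := LinearMap.toContinuousLinearMap
    ((LinearMap.toContinuousLinearMap : (E →ₗ[ℝ] ℝ) ≃ₗ[ℝ] (E →L[ℝ] ℝ)).toLinearMap ∘ₗ Q)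
  let b' : E →L[ℝ] ℝ := LinearMap.toContinuousLinearMap b
  have h : f = fun x => Q' x x + b' x + c := funext hf
  rw [h]
  exact ((Q'.contDiff.clm_apply contDiff_id).add b'.contDiff).add contDiff_const

/-- A differentiable convex function lies above its tangent planes. -/
theorem ConvexOn.add_hasFDerivAt_le {f : E → ℝ} (hf : ConvexOn ℝ Set.univ f) {f' : E →L[ℝ] ℝ}
    {x : E} (hx : HasFDerivAt f f' x) (h : E) : f x + f' h ≤ f (x + h) := by
  have hline : ConvexOn ℝ Set.univ (fun t : ℝ => f (AffineMap.lineMap x (x + h) t)) :=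
    hf.comp_affineMap (AffineMap.lineMap x (x + h))
  have hd : HasDerivAt (fun t : ℝ => f (AffineMap.lineMap x (x + h) t)) (f' h) 0 := by
    have h1 : HasDerivAt (AffineMap.lineMap x (x + h) : ℝ → E) (x + h - x) 0 :=
      AffineMap.hasDerivAt_lineMap
    rw [add_sub_cancel_left] at h1
    refine HasFDerivAt.comp_hasDerivAt (0 : ℝ) ?_ h1
    simpa using hx
  have := hline.le_slope_of_hasDerivAt (Set.mem_univ 0) (Set.mem_univ 1) one_pos hd
  simp [slope_def_field] at this
  linarith

/-- The remainder of the first-order Taylor expansion of a `C²` map is quadratic, uniformly on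
bounded sets. -/
theorem ContDiff.exists_taylor_bound [FiniteDimensional ℝ E] {f : E → F} (hf : ContDiff ℝ 2 f)
    (R : ℝ) : ∃ C, 0 ≤ C ∧ ∀ x h : E, ‖x‖ ≤ R → ‖h‖ ≤ R →
      ‖f (x + h) - f x - fderiv ℝ f x h‖ ≤ C * ‖h‖ ^ 2 := by
  have hf' : ContDiff ℝ 1 (fderiv ℝ f) := hf.fderiv_right (by norm_num)
  have hf'' : Continuous (fderiv ℝ (fderiv ℝ f)) := hf'.continuous_fderiv one_ne_zero
  obtain ⟨C, hC⟩ := (isCompact_closedBall (0 : E) (R + R)).exists_bound_of_continuousOn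
    (f := fderiv ℝ (fderiv ℝ f)) hf''.continuousOn
  refine ⟨max C 0, le_max_right _ _, fun x h hx hh => ?_⟩
  have hball : ∀ y ∈ segment ℝ x (x + h), y ∈ Metric.closedBall (0 : E) (R + R) ∧
      ‖y - x‖ ≤ ‖h‖ := by
    intro y hy
    have hyx : ‖y - x‖ ≤ ‖h‖ := by
      simpa using norm_sub_le_of_mem_segment hy
    refine ⟨?_, hyx⟩
    rw [mem_closedBall_zero_iff]
    calc ‖y‖ = ‖x + (y - x)‖ := by rw [add_sub_cancel]
      _ ≤ ‖x‖ + ‖y - x‖ := norm_add_le _ _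
      _ ≤ R + R := add_le_add hx (hyx.trans hh)
  have hlip : ∀ y ∈ segment ℝ x (x + h), ‖fderiv ℝ f y - fderiv ℝ f x‖ ≤ max C 0 * ‖h‖ := by
    intro y hy
    refine (Convex.norm_image_sub_le_of_norm_fderiv_le (𝕜 := ℝ) (C := max C 0)
      (fun z _ => (hf'.differentiable one_ne_zero) z)
      (fun z hz => (hC z (hball z hz).1).trans (le_max_left _ _))
      (convex_segment x (x + h)) (left_mem_segment ℝ _ _) hy).trans ?_
    exact mul_le_mul_of_nonneg_left (hball y hy).2 (le_max_right _ _)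
  have := Convex.norm_image_sub_le_of_norm_fderiv_le' (𝕜 := ℝ) (φ := fderiv ℝ f x)
    (fun z _ => (hf.differentiable two_ne_zero) z) hlip
    (convex_segment x (x + h)) (left_mem_segment ℝ _ _) (right_mem_segment ℝ _ _)
  rw [add_sub_cancel_left] at this
  linarith

/-- A `C¹` function is Lipschitz on bounded sets. -/
theorem ContDiff.exists_lipschitz_bound [FiniteDimensional ℝ E] {f : E → F} (hf : ContDiff ℝ 1 f)
    (R : ℝ) : ∃ C, 0 ≤ C ∧ ∀ x y : E, ‖x‖ ≤ R → ‖y‖ ≤ R → ‖f y - f x‖ ≤ C * ‖y - x‖ := by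
  obtain ⟨C, hC⟩ := (isCompact_closedBall (0 : E) R).exists_bound_of_continuousOn
    (hf.continuous_fderiv one_ne_zero).continuousOn
  refine ⟨max C 0, le_max_right _ _, fun x y hx hy => ?_⟩
  exact Convex.norm_image_sub_le_of_norm_fderiv_le (𝕜 := ℝ) (C := max C 0)
      (fun z _ => (hf.differentiable one_ne_zero) z)
      (fun z hz => (hC z hz).trans (le_max_left _ _))
      (convex_closedBall 0 R) (by simpa using hx) (by simpa using hy)

/-- The derivative of a map of two variables is the sum of its partial derivatives. -/
theorem fderiv_prod_apply {G : Type*} [NormedAddCommGroup G] [NormedSpace ℝ G] {g : E × F → G}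
    {x : E} {y : F} (hg : DifferentiableAt ℝ g (x, y)) (dx : E) (dy : F) :
    fderiv ℝ g (x, y) (dx, dy) =
      fderiv ℝ (fun x' => g (x', y)) x dx + fderiv ℝ (fun y' => g (x, y')) y dy := by
  have hx : HasFDerivAt (fun x' => g (x', y)) _ x :=
    HasFDerivAt.comp (g := g) x hg.hasFDerivAt (hasFDerivAt_prodMk_left x y)
  have hy : HasFDerivAt (fun y' => g (x, y')) _ y :=
    HasFDerivAt.comp (g := g) y hg.hasFDerivAt (hasFDerivAt_prodMk_right x y)
  rw [hx.fderiv, hy.fderiv]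
  simp [← map_add]

end Analysis

/-! ### Smoothness of the dynamics -/

namespace BilinearModel

variable {d m H : ℕ}

section

attribute [local instance] Matrix.linftyOpNormedRing Matrix.linftyOpNormedAlgebra

theorem contDiff_expP_apply (M : BilinearModel d m H) (i j : Fin d) {n : WithTop ℕ∞} :
    ContDiff ℝ n fun v => M.expP v i j := by
  have hexp : ContDiff ℝ n (NormedSpace.exp : Matrix (Fin d) (Fin d) ℝ → _) :=
    contDiff_iff_contDiffAt.2 fun x => (NormedSpace.exp_analytic (𝕂 := ℝ) x).contDiffAt
  have hlin : ContDiff ℝ n fun v : Fin m → ℝ => M.T • ∑ j, v j • M.G j :=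
    ContDiff.const_smul M.T
      (ContDiff.sum fun j _ => ContDiff.smul (contDiff_apply ℝ ℝ j) contDiff_const)
  exact (LinearMap.toContinuousLinearMap (Matrix.entryLinearMap ℝ ℝ i j)).contDiff.comp
    (hexp.comp hlin)

end

theorem contDiff_F (M : BilinearModel d m H) (k : Fin H) {n : WithTop ℕ∞} :
    ContDiff ℝ n fun p : (Fin d → ℝ) × (Fin m → ℝ) => M.F k p.1 p.2 := by
  refine contDiff_pi.2 fun i => ?_
  have h1 : ContDiff ℝ n fun z : Fin d → ℝ => M.expD.mulVec z :=
    (LinearMap.toContinuousLinearMap (Matrix.mulVecLin M.expD)).contDiff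
  have h2 : ContDiff ℝ n fun v : Fin m → ℝ => (M.Bbar k).mulVec v :=
    (LinearMap.toContinuousLinearMap (Matrix.mulVecLin (M.Bbar k))).contDiff
  have h3 := (h1.comp (contDiff_fst (E := Fin d → ℝ) (F := Fin m → ℝ))).add
    (h2.comp (contDiff_snd (E := Fin d → ℝ) (F := Fin m → ℝ)))
  change ContDiff ℝ n fun p : (Fin d → ℝ) × (Fin m → ℝ) =>
    ∑ j, M.expP p.2 i j * (M.expD.mulVec p.1 + (M.Bbar k).mulVec p.2) j
  exact ContDiff.sum fun j _ =>
    ((M.contDiff_expP_apply i j).comp contDiff_snd).mul (contDiff_pi.1 h3 j)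

/-- The joint derivative of the one-step map is the sum of its partial Jacobians. -/
theorem fderiv_F_apply (M : BilinearModel d m H) (k : Fin H) (z dz : Fin d → ℝ)
    (v dv : Fin m → ℝ) :
    fderiv ℝ (fun p : (Fin d → ℝ) × (Fin m → ℝ) => M.F k p.1 p.2) (z, v) (dz, dv) =
      M.Ajac k z v dz + M.Bjac k z v dv := by
  exact fderiv_prod_apply ((M.contDiff_F k (n := 1)).differentiable one_ne_zero (z, v)) dz dv

end BilinearModel

namespace BilinearMPC

variable {d m H : ℕ} (P : BilinearMPC d m H)

theorem eq_linRollout {u dv : Fin H → Fin m → ℝ} {dz : Fin (H + 1) → Fin d → ℝ} (h0 : dz 0 = 0)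
    (hs : ∀ k : Fin H, dz k.succ = P.model.Ajac k (P.rollout u k.castSucc) (u k) (dz k.castSucc) +
      P.model.Bjac k (P.rollout u k.castSucc) (u k) (dv k)) : dz = P.linRollout u dv := by
  funext k
  induction k using Fin.induction with
  | zero => exact h0
  | succ k ih => rw [hs, ih]; rfl

theorem contDiff_rollout {n : WithTop ℕ∞} : ContDiff ℝ n P.rollout := by
  refine contDiff_pi.2 fun k => ?_
  induction k using Fin.induction with
  | zero => exact contDiff_const
  | succ k ih => exact (P.model.contDiff_F k).comp (ih.prodMk (contDiff_apply ℝ _ k))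

/-- The linearized trajectory is the derivative of the nonlinear one with respect to the
controls. -/
theorem fderiv_rollout_apply (u du : Fin H → Fin m → ℝ) :
    fderiv ℝ P.rollout u du = P.linRollout u du := by
  have hR : Differentiable ℝ P.rollout := P.contDiff_rollout.differentiable one_ne_zero
  have hk : ∀ k, HasFDerivAt (fun u => P.rollout u k)
      ((ContinuousLinearMap.proj k).comp (fderiv ℝ P.rollout u)) u := fun k =>
    hasFDerivAt_pi'.1 (hR u).hasFDerivAt k
  refine P.eq_linRollout ?_ fun k => ?_
  · exact congrArg (fun L => L du) ((hk 0).unique (hasFDerivAt_const P.z0 u))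
  · have hF := ((P.model.contDiff_F k (n := 1)).differentiable one_ne_zero
      (P.rollout u k.castSucc, u k)).hasFDerivAt
    have hs := hF.comp u ((hk k.castSucc).prodMk (hasFDerivAt_apply k u))
    exact (congrArg (fun L => L du) ((hk k.succ).unique hs)).trans
      (P.model.fderiv_F_apply k _ _ _ _)

/-! ### The linearized cost -/

theorem contDiff_cost {n : WithTop ℕ∞} :
    ContDiff ℝ n fun p : (Fin (H + 1) → Fin d → ℝ) × (Fin H → Fin m → ℝ) => P.cost p.1 p.2 := by
  have hz : ∀ k, ContDiff ℝ n
      fun p : (Fin (H + 1) → Fin d → ℝ) × (Fin H → Fin m → ℝ) => p.1 k := fun k =>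
    (contDiff_apply ℝ (Fin d → ℝ) k).comp contDiff_fst
  have hu : ∀ k, ContDiff ℝ n
      fun p : (Fin (H + 1) → Fin d → ℝ) × (Fin H → Fin m → ℝ) => p.2 k := fun k =>
    (contDiff_apply ℝ (Fin m → ℝ) k).comp contDiff_snd
  have hprev : ∀ i, ContDiff ℝ n fun p : (Fin (H + 1) → Fin d → ℝ) × (Fin H → Fin m → ℝ) =>
      (Fin.cons P.uPrev p.2 : Fin (H + 1) → Fin m → ℝ) i := by
    refine Fin.cases ?_ fun i => ?_
    · simpa using contDiff_const
    · simpa using hu i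
  refine ContDiff.add (ContDiff.sum fun k _ => ContDiff.add ?_ ?_) ?_
  · exact (P.stage_quadratic k).contDiff.comp ((hz k.castSucc).prodMk (hu k))
  · exact (P.increment_quadratic k).contDiff.comp ((hu k).sub (hprev k.castSucc))
  · exact P.terminal_quadratic.contDiff.comp (hz (Fin.last H))

theorem convexOn_cost : ConvexOn ℝ Set.univ
    fun p : (Fin (H + 1) → Fin d → ℝ) × (Fin H → Fin m → ℝ) => P.cost p.1 p.2 := by
  refine ⟨convex_univ, fun p _ q _ s t hs ht hst => ?_⟩
  have hprev : ∀ i, (Fin.cons P.uPrev (s • p + t • q).2 : Fin (H + 1) → Fin m → ℝ) i =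
      s • (Fin.cons P.uPrev p.2 : Fin (H + 1) → Fin m → ℝ) i +
      t • (Fin.cons P.uPrev q.2 : Fin (H + 1) → Fin m → ℝ) i := by
    refine Fin.cases ?_ fun i => ?_
    · simp [← add_smul, hst]
    · simp
  simp only [cost, smul_eq_mul, mul_add, Finset.mul_sum]
  rw [add_add_add_comm, ← Finset.sum_add_distrib]
  refine add_le_add (Finset.sum_le_sum fun k _ => ?_)
    (P.terminal_quadratic.convexOn.2 trivial trivial hs ht hst)
  rw [add_add_add_comm]
  refine add_le_add ((P.stage_quadratic k).convexOn.2 (Set.mem_univ (p.1 k.castSucc, p.2 k))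
    (Set.mem_univ (q.1 k.castSucc, q.2 k)) hs ht hst) ?_
  rw [hprev]
  refine le_trans (le_of_eq (congrArg _ ?_))
    ((P.increment_quadratic k).convexOn.2 trivial trivial hs ht hst)
  simp only [Prod.snd_add, Prod.smul_snd, Pi.add_apply, Pi.smul_apply, smul_sub]
  abel

theorem Jlin_eq (u du : Fin H → Fin m → ℝ) :
    P.Jlin u du = P.cost (P.rollout u + fderiv ℝ P.rollout u du) (u + du) := by
  rw [fderiv_rollout_apply, Jlin]

@[simp]
theorem Jlin_zero (u : Fin H → Fin m → ℝ) : P.Jlin u 0 = P.J u := by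
  simp [Jlin_eq, J]

theorem convexOn_Jlin (u : Fin H → Fin m → ℝ) : ConvexOn ℝ Set.univ (P.Jlin u) := by
  refine ⟨convex_univ, fun v _ w _ s t hs ht hst => ?_⟩
  have h := P.convexOn_cost.2 (Set.mem_univ (P.rollout u + fderiv ℝ P.rollout u v, u + v))
    (Set.mem_univ (P.rollout u + fderiv ℝ P.rollout u w, u + w)) hs ht hst
  simp only [Jlin_eq]
  refine le_trans (le_of_eq ?_) h
  obtain rfl : t = 1 - s := by linarith
  congr 1
  · simp only [map_add, map_smul, Prod.smul_mk, Prod.mk_add_mk]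
    module
  · simp only [Prod.smul_mk, Prod.mk_add_mk]
    module

theorem continuous_Jlin {X : Type*} [TopologicalSpace X] {f g : X → Fin H → Fin m → ℝ}
    (hf : Continuous f) (hg : Continuous g) : Continuous fun x => P.Jlin (f x) (g x) := by
  simp only [Jlin_eq]
  have hR : Continuous (fderiv ℝ P.rollout) :=
    (P.contDiff_rollout (n := 1)).continuous_fderiv one_ne_zero
  have hz : Continuous fun x => P.rollout (f x) + fderiv ℝ P.rollout (f x) (g x) :=
    ((P.contDiff_rollout (n := 0)).continuous.comp hf).add ((hR.comp hf).clm_apply hg)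
  exact (P.contDiff_cost (n := 0)).continuous.comp (hz.prodMk (hf.add hg))

theorem continuous_J : Continuous P.J :=
  (P.contDiff_cost (n := 0)).continuous.comp
    ((P.contDiff_rollout (n := 0)).continuous.prodMk continuous_id)

/-- The derivative at `du = 0` of the linearized cost `Jlin u`, that is, of the objective along the
linearized dynamics. -/
noncomputable def reducedDeriv (u : Fin H → Fin m → ℝ) : (Fin H → Fin m → ℝ) →L[ℝ] ℝ :=
  (fderiv ℝ (fun p : (Fin (H + 1) → Fin d → ℝ) × (Fin H → Fin m → ℝ) => P.cost p.1 p.2)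
    (P.rollout u, u)).comp ((fderiv ℝ P.rollout u).prod (ContinuousLinearMap.id ℝ _))

theorem reducedDeriv_apply (u dv : Fin H → Fin m → ℝ) :
    P.reducedDeriv u dv =
      fderiv ℝ (fun p : (Fin (H + 1) → Fin d → ℝ) × (Fin H → Fin m → ℝ) => P.cost p.1 p.2)
        (P.rollout u, u) (P.linRollout u dv, dv) := by
  simp [reducedDeriv, fderiv_rollout_apply]

theorem hasFDerivAt_Jlin_zero (u : Fin H → Fin m → ℝ) :
    HasFDerivAt (P.Jlin u) (P.reducedDeriv u) 0 := by
  have hin : HasFDerivAt (fun v => (P.rollout u + fderiv ℝ P.rollout u v, u + v))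
      ((fderiv ℝ P.rollout u).prod (ContinuousLinearMap.id ℝ _)) 0 :=
    ((fderiv ℝ P.rollout u).hasFDerivAt.const_add _).prodMk ((hasFDerivAt_id 0).const_add u)
  have hc := ((P.contDiff_cost (n := 1)).differentiable one_ne_zero (P.rollout u, u)).hasFDerivAt
  have hp : (P.rollout u, u) = (P.rollout u + fderiv ℝ P.rollout u 0, u + 0) := by simp
  rw [show P.Jlin u = fun v => P.cost (P.rollout u + fderiv ℝ P.rollout u v) (u + v) from
    funext (P.Jlin_eq u), reducedDeriv]
  refine HasFDerivAt.comp (g := fun p : (Fin (H + 1) → Fin d → ℝ) × (Fin H → Fin m → ℝ) =>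
    P.cost p.1 p.2) 0 ?_ hin
  rw [← hp]
  exact hc

/-- The model error is quadratic in the step, uniformly on bounded sets: the trajectories differ
by a second-order Taylor remainder, and the cost is Lipschitz on bounded sets. -/
theorem exists_model_error_bound (R : ℝ) : ∃ C, 0 ≤ C ∧ ∀ u du : Fin H → Fin m → ℝ,
    ‖u‖ ≤ R → ‖du‖ ≤ R → |P.Jlin u du - P.J (u + du)| ≤ C * ‖du‖ ^ 2 := by
  obtain ⟨C, hC0, hC⟩ := (P.contDiff_rollout (n := 2)).exists_taylor_bound R
  obtain ⟨K₁, hK₁⟩ := (isCompact_closedBall (0 : Fin H → Fin m → ℝ)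
    (R + R)).exists_bound_of_continuousOn (f := P.rollout)
      (P.contDiff_rollout (n := 0)).continuous.continuousOn
  set K := max (K₁ + C * R ^ 2) (R + R)
  obtain ⟨L, hL0, hL⟩ := (P.contDiff_cost (n := 1)).exists_lipschitz_bound K
  refine ⟨L * C, mul_nonneg hL0 hC0, fun u du hu hdu => ?_⟩
  have htaylor := hC u du hu hdu
  have hsum : ‖u + du‖ ≤ R + R := norm_add_le_of_le hu hdu
  have hR : C * ‖du‖ ^ 2 ≤ C * R ^ 2 := by gcongr
  have hroll : ‖P.rollout (u + du)‖ ≤ K₁ := hK₁ _ (by simpa using hsum)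
  have hdiff : ‖P.rollout u + fderiv ℝ P.rollout u du - P.rollout (u + du)‖ ≤ C * ‖du‖ ^ 2 := by
    rw [norm_sub_rev, ← sub_sub]
    exact htaylor
  have hCR : 0 ≤ C * R ^ 2 := by positivity
  have hlin : ‖P.rollout u + fderiv ℝ P.rollout u du‖ ≤ K₁ + C * R ^ 2 := by
    rw [← add_sub_cancel (P.rollout (u + du)) (P.rollout u + fderiv ℝ P.rollout u du)]
    exact norm_add_le_of_le hroll (hdiff.trans hR)
  have hx : ‖(P.rollout (u + du), u + du)‖ ≤ K := by
    rw [Prod.norm_def]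
    exact max_le_max (by simpa using hroll.trans (by linarith)) hsum
  have hy : ‖(P.rollout u + fderiv ℝ P.rollout u du, u + du)‖ ≤ K := by
    rw [Prod.norm_def]
    exact max_le_max hlin hsum
  have h := hL _ _ hx hy
  rw [Prod.mk_sub_mk, sub_self, Prod.norm_mk, norm_zero, max_eq_left (norm_nonneg _)] at h
  rw [Jlin_eq, J, mul_assoc, ← Real.norm_eq_abs]
  exact h.trans (mul_le_mul_of_nonneg_left hdiff hL0)

/-! ### Trust-region subproblems -/

theorem mem_subFeasible_iff {u du : Fin H → Fin m → ℝ} {ε : ℝ} (hε : 0 ≤ ε) :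
    du ∈ P.subFeasible u ε ↔ P.Admissible (u + du) ∧ ‖du‖ ≤ ε := by
  rw [pi_norm_le_iff_of_nonneg hε]
  rfl

theorem admissible_iff {u : Fin H → Fin m → ℝ} :
    P.Admissible u ↔ u ∈ Set.Icc (fun _ => P.umin) (fun _ => P.umax) :=
  ⟨fun h => ⟨fun k => (h k).1, fun k => (h k).2⟩, fun h k => ⟨h.1 k, h.2 k⟩⟩

theorem isClosed_admissible : IsClosed {u | P.Admissible u} := by
  simp only [admissible_iff]
  exact isClosed_Icc

theorem Admissible.add_smul {P : BilinearMPC d m H} {u w : Fin H → Fin m → ℝ}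
    (hu : P.Admissible u) (hw : P.Admissible (u + w)) {t : ℝ} (h0 : 0 ≤ t) (h1 : t ≤ 1) :
    P.Admissible (u + t • w) := by
  rw [admissible_iff] at *
  have := (convex_Icc _ _) hu hw (sub_nonneg.2 h1) h0 (sub_add_cancel 1 t)
  convert this using 1
  module

theorem zero_mem_subFeasible {u : Fin H → Fin m → ℝ} (hu : P.Admissible u) {ε : ℝ}
    (hε : 0 ≤ ε) : 0 ∈ P.subFeasible u ε := by
  rw [mem_subFeasible_iff P hε]
  simpa using ⟨hu, hε⟩

theorem smul_mem_subFeasible {u w : Fin H → Fin m → ℝ} {ε t : ℝ} (hu : P.Admissible u)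
    (hw : P.Admissible (u + w)) (h0 : 0 ≤ t) (h1 : t ≤ 1) (ht : t * ‖w‖ ≤ ε) :
    t • w ∈ P.subFeasible u ε := by
  rw [mem_subFeasible_iff P ((mul_nonneg h0 (norm_nonneg w)).trans ht), norm_smul,
    Real.norm_of_nonneg h0]
  exact ⟨hu.add_smul hw h0 h1, ht⟩

theorem exists_isSubSolution {u : Fin H → Fin m → ℝ} (hu : P.Admissible u) {ε : ℝ}
    (hε : 0 < ε) : ∃ du, P.IsSubSolution u ε du := by
  have hcomp : IsCompact (P.subFeasible u ε) := by
    have : P.subFeasible u ε =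
        Metric.closedBall 0 ε ∩ (fun v => u + v) ⁻¹' {v | P.Admissible v} := by
      ext v
      rw [mem_subFeasible_iff P hε.le]
      simp [and_comm]
    rw [this]
    exact (isCompact_closedBall 0 ε).inter_right
      (P.isClosed_admissible.preimage (continuous_const_add u))
  exact hcomp.exists_isMinOn ⟨0, P.zero_mem_subFeasible hu hε.le⟩
    (P.continuous_Jlin continuous_const continuous_id).continuousOn

theorem IsSubSolution.pred_le {P : BilinearMPC d m H} {u du : Fin H → Fin m → ℝ} {ε : ℝ}
    (h : P.IsSubSolution u ε du) {dv : Fin H → Fin m → ℝ} (hdv : dv ∈ P.subFeasible u ε) :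
    P.pred u dv ≤ P.pred u du :=
  sub_le_sub_left (h.2 dv hdv) _

theorem IsSubSolution.pred_nonneg {P : BilinearMPC d m H} {u du : Fin H → Fin m → ℝ} {ε : ℝ}
    (h : P.IsSubSolution u ε du) (hu : P.Admissible u) (hε : 0 ≤ ε) : 0 ≤ P.pred u du := by
  have := h.pred_le (P.zero_mem_subFeasible hu hε)
  simpa [pred] using this

/-- By convexity of the linearized cost, a step shortened by the factor `t` keeps at least the
fraction `t` of its predicted decrease. -/
theorem mul_pred_le_pred_smul (u w : Fin H → Fin m → ℝ) {t : ℝ} (h0 : 0 ≤ t) (h1 : t ≤ 1) :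
    t * P.pred u w ≤ P.pred u (t • w) := by
  have h := (P.convexOn_Jlin u).2 (Set.mem_univ 0) (Set.mem_univ w) (sub_nonneg.2 h1) h0
    (sub_add_cancel 1 t)
  simp only [smul_zero, zero_add, smul_eq_mul] at h
  rw [pred, pred]
  linarith

/-- The predicted decrease vanishes exactly if there is no feasible descent direction of the
linearized cost. -/
theorem IsSubSolution.pred_eq_zero_iff {P : BilinearMPC d m H} {u du : Fin H → Fin m → ℝ} {ε : ℝ}
    (h : P.IsSubSolution u ε du) (hu : P.Admissible u) (hε : 0 < ε) :
    P.pred u du = 0 ↔ ∀ dv ∈ P.subFeasible u ε, 0 ≤ P.reducedDeriv u dv := by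
  constructor
  · intro h0 dv hdv
    have hmin : IsMinOn (P.Jlin u) (P.subFeasible u ε) 0 := fun w hw => by
      have := h.pred_le hw
      rw [h0, pred] at this
      exact sub_nonpos.1 this
    refine hmin.localize.hasFDerivWithinAt_nonneg (P.hasFDerivAt_Jlin_zero u).hasFDerivWithinAt
      (mem_posTangentConeAt_of_segment_subset ?_)
    rintro _ ⟨a, t, ha, ht, hat, rfl⟩
    rw [mem_subFeasible_iff P hε.le] at hdv
    have := P.smul_mem_subFeasible (ε := ε) hu hdv.1 ht (by linarith)
      ((mul_le_of_le_one_left (norm_nonneg _) (by linarith)).trans hdv.2)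
    simpa using this
  · intro hd
    refine le_antisymm ?_ (h.pred_nonneg hu hε.le)
    have h1 := (P.convexOn_Jlin u).add_hasFDerivAt_le (P.hasFDerivAt_Jlin_zero u) du
    have h2 := hd du h.1
    rw [zero_add] at h1
    rw [pred]
    linarith

/-! ### Karush-Kuhn-Tucker points -/

/-- A linear functional on families of vectors is given by its values on the standard basis. -/
theorem apply_eq_sum_single {p q : ℕ} (ψ : (Fin p → Fin q → ℝ) →ₗ[ℝ] ℝ) (r : Fin p → Fin q → ℝ) :
    ψ r = ∑ k, ∑ i, ψ (Pi.single k (Pi.single i 1)) * r k i := by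
  have hr : r = ∑ k, Pi.single k (∑ i, r k i • Pi.single i (1 : ℝ)) := by
    simp [Finset.univ_sum_single, ← pi_eq_sum_univ']
  have hk : ∀ k, ψ (Pi.single k (∑ i, r k i • Pi.single i (1 : ℝ))) =
      ∑ i, ψ (Pi.single k (Pi.single i 1)) * r k i := fun k => by
    rw [← LinearMap.single_apply ℝ, map_sum, map_sum]
    refine Finset.sum_congr rfl fun i _ => ?_
    rw [map_smul, map_smul, smul_eq_mul, mul_comm, LinearMap.single_apply]
  conv_lhs => rw [hr]
  rw [map_sum]
  exact Finset.sum_congr rfl fun k _ => hk k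

/-- If there is no feasible descent direction, then the positive and negative parts of the reduced
derivative are multipliers of the box constraints: a coordinate with nonzero derivative has to sit
at the corresponding bound. -/
theorem exists_box_multipliers {u : Fin H → Fin m → ℝ} (hu : P.Admissible u) {ε : ℝ} (hε : 0 < ε)
    (hd : ∀ dv ∈ P.subFeasible u ε, 0 ≤ P.reducedDeriv u dv) :
    ∃ mlo mhi : Fin H → Fin m → ℝ, (∀ k j, 0 ≤ mlo k j) ∧ (∀ k j, 0 ≤ mhi k j) ∧
      (∀ k j, mlo k j * (P.umin j - u k j) = 0) ∧ (∀ k j, mhi k j * (u k j - P.umax j) = 0) ∧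
      ∀ dv, P.reducedDeriv u dv + ∑ k, (mhi k - mlo k) ⬝ᵥ dv k = 0 := by
  set g : Fin H → Fin m → ℝ := fun k j => P.reducedDeriv u (Pi.single k (Pi.single j 1)) with hg
  have hcoord : ∀ k j (t : ℝ), |t| ≤ ε → P.umin j ≤ u k j + t → u k j + t ≤ P.umax j →
      0 ≤ t * g k j := by
    intro k j t ht hlo hhi
    have hmem : t • Pi.single k (Pi.single j (1 : ℝ)) ∈ P.subFeasible u ε := by
      rw [mem_subFeasible_iff P hε.le, admissible_iff]
      refine ⟨⟨fun k' j' => ?_, fun k' j' => ?_⟩, ?_⟩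
      · by_cases hk : k' = k
        · subst hk
          by_cases hj : j' = j
          · subst hj
            simpa using hlo
          · simpa [hj] using (hu k').1 j'
        · simpa [hk] using (hu k').1 j'
      · by_cases hk : k' = k
        · subst hk
          by_cases hj : j' = j
          · subst hj
            simpa using hhi
          · simpa [hj] using (hu k').2 j'
        · simpa [hk] using (hu k').2 j'
      · simpa [norm_smul, Pi.norm_single] using ht
    simpa [hg] using hd _ hmem
  refine ⟨fun k j => max (g k j) 0, fun k j => max (-g k j) 0, fun k j => le_max_right _ _,
    fun k j => le_max_right _ _, fun k j => ?_, fun k j => ?_, fun dv => ?_⟩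
  · rcases le_or_gt (g k j) 0 with h | h
    · simp [h]
    · refine mul_eq_zero_of_right _ (sub_eq_zero.2 (le_antisymm ((hu k).1 j) ?_))
      by_contra! hlt
      have ht : 0 < min ε (u k j - P.umin j) := lt_min hε (sub_pos.2 hlt)
      have := hcoord k j (-min ε (u k j - P.umin j))
        (by rw [abs_neg, abs_of_pos ht]; exact min_le_left _ _)
        (by linarith [min_le_right ε (u k j - P.umin j)]) (by linarith [(hu k).2 j])
      nlinarith
  · rcases le_or_gt 0 (g k j) with h | h
    · simp [h]
    · refine mul_eq_zero_of_right _ (sub_eq_zero.2 (le_antisymm ((hu k).2 j) ?_))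
      by_contra! hlt
      have ht : 0 < min ε (P.umax j - u k j) := lt_min hε (sub_pos.2 hlt)
      have := hcoord k j (min ε (P.umax j - u k j))
        (by rw [abs_of_pos ht]; exact min_le_left _ _)
        (by linarith [(hu k).1 j]) (by linarith [min_le_right ε (P.umax j - u k j)])
      nlinarith
  · have hsum := apply_eq_sum_single (P.reducedDeriv u).toLinearMap dv
    simp only [ContinuousLinearMap.coe_coe] at hsum
    rw [hsum, ← Finset.sum_add_distrib]
    refine Finset.sum_eq_zero fun k _ => ?_
    rw [dotProduct, ← Finset.sum_add_distrib]
    refine Finset.sum_eq_zero fun j _ => ?_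
    have : max (-g k j) 0 - max (g k j) 0 = -g k j := by
      rcases le_total (g k j) 0 with h | h <;> simp [h]
    simp only [Pi.sub_apply, this]
    ring

/-- The residual of the linearized dynamics along `u`, preceded by the initial deviation. -/
noncomputable def linResidual (u : Fin H → Fin m → ℝ) :
    (Fin (H + 1) → Fin d → ℝ) × (Fin H → Fin m → ℝ) →ₗ[ℝ]
      (Fin d → ℝ) × (Fin H → Fin d → ℝ) where
  toFun p := (p.1 0, fun k => P.model.Ajac k (P.rollout u k.castSucc) (u k) (p.1 k.castSucc) +
    P.model.Bjac k (P.rollout u k.castSucc) (u k) (p.2 k) - p.1 k.succ)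
  map_add' p q := by
    ext <;> simp
    ring
  map_smul' c p := by
    ext <;> simp
    ring

/-- A linear functional that vanishes on the trajectories of the linearized dynamics is a
combination of the dynamics constraints. This is where multipliers of the dynamics come from, with
no constraint qualification. -/
theorem exists_dynamics_multipliers (u : Fin H → Fin m → ℝ)
    (L : (Fin (H + 1) → Fin d → ℝ) × (Fin H → Fin m → ℝ) →ₗ[ℝ] ℝ)
    (hL : ∀ dv, L (P.linRollout u dv, dv) = 0) :
    ∃ lam : Fin H → Fin d → ℝ, ∀ (dz : Fin (H + 1) → Fin d → ℝ) (dv : Fin H → Fin m → ℝ),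
      dz 0 = 0 → L (dz, dv) + ∑ k, lam k ⬝ᵥ
        (P.model.Ajac k (P.rollout u k.castSucc) (u k) (dz k.castSucc) +
          P.model.Bjac k (P.rollout u k.castSucc) (u k) (dv k) - dz k.succ) = 0 := by
  have hann : L ∈ (LinearMap.ker (P.linResidual u)).dualAnnihilator := by
    rw [Submodule.mem_dualAnnihilator]
    rintro ⟨dz, dv⟩ hker
    have h1 : dz 0 = 0 := congrArg Prod.fst hker
    have h2 := congrArg Prod.snd hker
    rw [P.eq_linRollout h1 fun k => (sub_eq_zero.1 (congrFun h2 k)).symm, hL]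
  rw [← LinearMap.range_dualMap_eq_dualAnnihilator_ker] at hann
  obtain ⟨φ, rfl⟩ := hann
  refine ⟨fun k i => -φ (0, Pi.single k (Pi.single i 1)), fun dz dv h0 => ?_⟩
  set r : Fin H → Fin d → ℝ := fun k =>
    P.model.Ajac k (P.rollout u k.castSucc) (u k) (dz k.castSucc) +
      P.model.Bjac k (P.rollout u k.castSucc) (u k) (dv k) - dz k.succ with hr
  have hres : P.linResidual u (dz, dv) = (0, r) := Prod.ext h0 rfl
  rw [LinearMap.dualMap_apply, hres]
  change φ (0, r) + ∑ k, _ ⬝ᵥ r k = 0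
  have hsum := apply_eq_sum_single
    (φ ∘ₗ LinearMap.inr ℝ (Fin d → ℝ) (Fin H → Fin d → ℝ)) r
  simp only [LinearMap.comp_apply, LinearMap.inr_apply] at hsum
  simp [hsum, dotProduct]

/-- Stationarity in reduced form: the adjoint multipliers can be eliminated. -/
theorem isKKT_rollout_iff {u : Fin H → Fin m → ℝ} (hu : P.Admissible u) {ε : ℝ} (hε : 0 < ε) :
    P.IsKKT (P.rollout u) u ↔ ∀ dv ∈ P.subFeasible u ε, 0 ≤ P.reducedDeriv u dv := by
  constructor
  · rintro ⟨-, -, -, lam, mlo, mhi, hlo, hhi, hclo, hchi, hstat⟩ dv hdv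
    have h := hstat (P.linRollout u dv) dv rfl
    rw [← reducedDeriv_apply] at h
    have hdyn : ∀ k : Fin H, P.model.Ajac k (P.rollout u k.castSucc) (u k)
        (P.linRollout u dv k.castSucc) + P.model.Bjac k (P.rollout u k.castSucc) (u k) (dv k)
          - P.linRollout u dv k.succ = 0 := fun k => sub_eq_zero.2 rfl
    simp only [hdyn, dotProduct_zero, Finset.sum_const_zero, add_zero] at h
    suffices ∑ k, (mhi k - mlo k) ⬝ᵥ dv k ≤ 0 by linarith
    refine Finset.sum_nonpos fun k _ => Finset.sum_nonpos fun j _ => ?_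
    have h1 : P.umin j ≤ u k j + dv k j := (hdv.1 k).1 j
    have h2 : u k j + dv k j ≤ P.umax j := (hdv.1 k).2 j
    -- by complementarity, `dv` may be replaced by the slack of `u + dv` in each bound
    have h3 := mul_nonneg (hlo k j) (sub_nonneg.2 h1)
    have h4 := mul_nonneg (hhi k j) (sub_nonneg.2 h2)
    have h5 := hclo k j
    have h6 := hchi k j
    rw [Pi.sub_apply]
    linarith
  · intro hd
    obtain ⟨mlo, mhi, hlo, hhi, hclo, hchi, hg⟩ := P.exists_box_multipliers hu hε hd
    let L : (Fin (H + 1) → Fin d → ℝ) × (Fin H → Fin m → ℝ) →ₗ[ℝ] ℝ :=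
      (fderiv ℝ (fun p : (Fin (H + 1) → Fin d → ℝ) × (Fin H → Fin m → ℝ) => P.cost p.1 p.2)
        (P.rollout u, u)).toLinearMap +
      ∑ k, (dotProductBilin ℝ ℝ (mhi k - mlo k)) ∘ₗ LinearMap.proj k ∘ₗ
        LinearMap.snd ℝ (Fin (H + 1) → Fin d → ℝ) (Fin H → Fin m → ℝ)
    have hLapply : ∀ dz dv, L (dz, dv) =
        fderiv ℝ (fun p : (Fin (H + 1) → Fin d → ℝ) × (Fin H → Fin m → ℝ) => P.cost p.1 p.2)
          (P.rollout u, u) (dz, dv) + ∑ k, (mhi k - mlo k) ⬝ᵥ dv k := fun dz dv => by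
      simp [L, LinearMap.sum_apply]
    obtain ⟨lam, hlam⟩ := P.exists_dynamics_multipliers u L fun dv => by
      rw [hLapply, ← reducedDeriv_apply, hg]
    refine ⟨rfl, fun k => rfl, hu, lam, mlo, mhi, hlo, hhi, hclo, hchi, fun dz dv h0 => ?_⟩
    rw [add_right_comm, ← hLapply]
    exact hlam dz dv h0

/-! ### Locally uniform decrease near a non-stationary control sequence -/

theorem exists_pred_pos_of_not_isKKT {u : Fin H → Fin m → ℝ} (hu : P.Admissible u)
    (hK : ¬ P.IsKKT (P.rollout u) u) : ∃ dv, P.Admissible (u + dv) ∧ 0 < P.pred u dv := by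
  obtain ⟨dv, hdv⟩ := P.exists_isSubSolution hu one_pos
  refine ⟨dv, hdv.1.1, (hdv.pred_nonneg hu zero_le_one).lt_of_ne' fun h0 => hK ?_⟩
  rwa [P.isKKT_rollout_iff hu one_pos, ← hdv.pred_eq_zero_iff hu one_pos]

/-- If some admissible point `ustar + dv` promises a decrease at `ustar`, then heading for that same
point promises at least half of it from all nearby controls; shortening the step to fit into the
trust region shows that the predicted decrease is at least linear in the radius. -/
theorem exists_eventually_mul_min_le_pred {ustar dv : Fin H → Fin m → ℝ}
    (hdv : P.Admissible (ustar + dv)) (hp : 0 < P.pred ustar dv) :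
    ∃ c, 0 < c ∧ ∀ᶠ u in 𝓝 ustar, P.Admissible u → ∀ ε, 0 < ε → ∀ du,
      P.IsSubSolution u ε du → c * min 1 ε ≤ P.pred u du := by
  set M := ‖dv‖ + 1 with hM
  have hM1 : 1 ≤ M := by linarith [norm_nonneg dv]
  have hM0 : 0 < M := by linarith
  have hw : Continuous fun u : Fin H → Fin m → ℝ => ustar + dv - u := by fun_prop
  have hJlin : Continuous fun u => P.Jlin u (ustar + dv - u) := P.continuous_Jlin continuous_id hw
  have hpred : Continuous fun u => P.pred u (ustar + dv - u) := by
    simp only [pred, Jlin_zero]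
    exact P.continuous_J.sub hJlin
  have h1 : ∀ᶠ u in 𝓝 ustar, P.pred ustar dv / 2 < P.pred u (ustar + dv - u) :=
    hpred.continuousAt.eventually_const_lt (by
      beta_reduce
      rw [add_sub_cancel_left]
      linarith)
  have h2 : ∀ᶠ u in 𝓝 ustar, ‖ustar + dv - u‖ < M :=
    hw.norm.continuousAt.eventually_lt_const (by
      beta_reduce
      rw [add_sub_cancel_left]
      linarith)
  refine ⟨P.pred ustar dv / 2 / M, by positivity, ?_⟩
  filter_upwards [h1, h2] with u hu1 hu2 hu ε hε du hdu
  have hmin : 0 < min 1 ε := lt_min one_pos hε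
  have ht0 : 0 ≤ min 1 ε / M := by positivity
  have ht1 : min 1 ε / M ≤ 1 := (div_le_one hM0).2 ((min_le_left _ _).trans hM1)
  have htw : min 1 ε / M * ‖ustar + dv - u‖ ≤ ε :=
    calc min 1 ε / M * ‖ustar + dv - u‖ ≤ min 1 ε / M * M := by gcongr
      _ = min 1 ε := div_mul_cancel₀ _ hM0.ne'
      _ ≤ ε := min_le_right _ _
  have hmem := P.smul_mem_subFeasible hu (w := ustar + dv - u) (by rwa [add_sub_cancel])
    ht0 ht1 htw
  calc P.pred ustar dv / 2 / M * min 1 ε = min 1 ε / M * (P.pred ustar dv / 2) := by ring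
    _ ≤ min 1 ε / M * P.pred u (ustar + dv - u) := by gcongr
    _ ≤ P.pred u ((min 1 ε / M) • (ustar + dv - u)) := P.mul_pred_le_pred_smul _ _ ht0 ht1
    _ ≤ P.pred u du := hdu.pred_le hmem

/-- Near controls at which a decrease is possible, the quadratic model error is eventually dominated
by the linear predicted decrease. -/
theorem exists_eventually_model_error_lt {ustar dv : Fin H → Fin m → ℝ}
    (hdv : P.Admissible (ustar + dv)) (hp : 0 < P.pred ustar dv) {θ : ℝ} (hθ : 0 < θ) :
    ∃ ε₁, 0 < ε₁ ∧ ∀ᶠ u in 𝓝 ustar, P.Admissible u → ∀ ε, 0 < ε → ε ≤ ε₁ → ∀ du,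
      P.IsSubSolution u ε du → |P.Jlin u du - P.J (u + du)| < θ * P.pred u du := by
  obtain ⟨c, hc, hev⟩ := P.exists_eventually_mul_min_le_pred hdv hp
  obtain ⟨C, hC0, hC⟩ := P.exists_model_error_bound (‖ustar‖ + 1)
  have hC1 : 0 < C + 1 := by linarith
  refine ⟨min 1 (θ * c / (C + 1)), lt_min one_pos (by positivity), ?_⟩
  have hnorm : ∀ᶠ u in 𝓝 ustar, ‖u‖ < ‖ustar‖ + 1 :=
    continuous_norm.continuousAt.eventually_lt_const (by linarith)
  filter_upwards [hev, hnorm] with u hpu hun hu ε hε hε₁ du hdu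
  have hε1 : ε ≤ 1 := hε₁.trans (min_le_left _ _)
  have hεθ : ε * (C + 1) ≤ θ * c := (le_div_iff₀ hC1).1 (hε₁.trans (min_le_right _ _))
  have hpred := hpu hu ε hε du hdu
  rw [min_eq_right hε1] at hpred
  have hdun : ‖du‖ ≤ ε := ((P.mem_subFeasible_iff hε.le).1 hdu.1).2
  calc |P.Jlin u du - P.J (u + du)| ≤ C * ‖du‖ ^ 2 :=
        hC u du hun.le (hdun.trans (by linarith [norm_nonneg ustar]))
    _ ≤ C * ε ^ 2 := by gcongr
    _ < (C + 1) * ε ^ 2 := by nlinarith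
    _ = ε * (C + 1) * ε := by ring
    _ ≤ θ * c * ε := by gcongr
    _ = θ * (c * ε) := by ring
    _ ≤ θ * P.pred u du := by gcongr

theorem accepts_of_model_error_le {η : ℝ} {u du : Fin H → Fin m → ℝ}
    (h : |P.Jlin u du - P.J (u + du)| ≤ (1 - η) * P.pred u du) : P.Accepts η u du := by
  have h1 := neg_le_of_abs_le h
  have h2 : P.pred u du = P.J u - P.Jlin u du := by rw [pred, Jlin_zero]
  rw [Accepts]
  linarith

/-! ### Runs of the algorithm -/

namespace IsSCPRun

variable {P} {η : ℝ} {u : ℕ → Fin H → Fin m → ℝ} {ε : ℕ → ℝ} {du : ℕ → Fin H → Fin m → ℝ}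

theorem admissible (h : P.IsSCPRun η u ε du) (n : ℕ) : P.Admissible (u n) := by
  induction n with
  | zero => exact h.init_admissible
  | succ n ih =>
    by_cases ha : P.Accepts η (u n) (du n)
    · rw [(h.accept n ha).1]
      exact (h.solves n).1.1
    · rwa [(h.reject n ha).1]

theorem radius_pos (h : P.IsSCPRun η u ε du) (n : ℕ) : 0 < ε n := by
  induction n with
  | zero => exact h.init_radius
  | succ n ih =>
    by_cases ha : P.Accepts η (u n) (du n)
    · rwa [(h.accept n ha).2]
    · rw [(h.reject n ha).2]
      exact half_pos ih

theorem radius_antitone (h : P.IsSCPRun η u ε du) : Antitone ε := by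
  refine antitone_nat_of_succ_le fun n => ?_
  by_cases ha : P.Accepts η (u n) (du n)
  · exact (h.accept n ha).2.le
  · rw [(h.reject n ha).2]
    exact half_le_self (h.radius_pos n).le

theorem J_antitone (h : P.IsSCPRun η u ε du) (hη : 0 ≤ η) : Antitone fun n => P.J (u n) := by
  refine antitone_nat_of_succ_le fun n => ?_
  by_cases ha : P.Accepts η (u n) (du n)
  · rw [(h.accept n ha).1]
    have hp := (h.solves n).pred_nonneg (h.admissible n) (h.radius_pos n).le
    exact sub_nonneg.1 ((mul_nonneg hη hp).trans ha)
  · rw [(h.reject n ha).1]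

/-- Once a decrease is predicted, a step is accepted after finitely many halvings of the radius. -/
theorem exists_accepts (h : P.IsSCPRun η u ε du) (hη : η < 1) {n : ℕ}
    (hp : 0 < P.pred (u n) (du n)) : ∃ l, P.Accepts η (u (n + l)) (du (n + l)) := by
  by_contra! hrej
  have hconst : ∀ l, u (n + l) = u n ∧ ε (n + l) = ε n * (1 / 2) ^ l := by
    intro l
    induction l with
    | zero => simp
    | succ l ih =>
      obtain ⟨h1, h2⟩ := h.reject (n + l) (hrej l)
      rw [← add_assoc, h1, h2, ih.1, ih.2, pow_succ]
      exact ⟨rfl, by ring⟩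
  obtain ⟨ε₁, hε₁, hev⟩ := P.exists_eventually_model_error_lt (h.solves n).1.1 hp (sub_pos.2 hη)
  obtain ⟨l, hl⟩ := exists_pow_lt_of_lt_one (div_pos hε₁ (h.radius_pos n))
    (by norm_num : (1 / 2 : ℝ) < 1)
  have hsol := h.solves (n + l)
  have hpos := h.radius_pos (n + l)
  have hacc := hrej l
  rw [(hconst l).1] at hsol hacc
  refine hacc (P.accepts_of_model_error_le
    (hev.self_of_nhds (h.admissible n) _ hpos ?_ _ hsol).le)
  rw [(hconst l).2, mul_comm]
  exact ((lt_div_iff₀ (h.radius_pos n)).1 hl).le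

theorem J_le_of_mapClusterPt (h : P.IsSCPRun η u ε du) (hη : 0 ≤ η) {ustar : Fin H → Fin m → ℝ}
    (hcl : MapClusterPt ustar atTop u) (n : ℕ) : P.J ustar ≤ P.J (u n) := by
  by_contra! hlt
  obtain ⟨k, hk, hnk⟩ := ((hcl.frequently
    (P.continuous_J.continuousAt.eventually_const_lt hlt)).and_eventually
      (eventually_ge_atTop n)).exists
  exact absurd (h.J_antitone hη hnk) (not_le.2 hk)

/-- The cost cannot drop by a fixed amount at infinitely many visits close to an accumulation
point. -/
theorem not_eventually_decrease (h : P.IsSCPRun η u ε du) (hη : 0 ≤ η)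
    {ustar : Fin H → Fin m → ℝ} (hcl : MapClusterPt ustar atTop u) {r β : ℝ} (hr : 0 < r)
    (hβ : 0 < β) :
    ¬ ∀ᶠ n in atTop, u n ∈ Metric.ball ustar r → β ≤ P.J (u n) - P.J (u (n + 1)) := by
  intro hev
  obtain ⟨n, ⟨hJ, hball⟩, hn⟩ := ((hcl.frequently
    ((P.continuous_J.continuousAt.eventually_lt_const (lt_add_of_pos_right _ hβ)).and
      (Metric.ball_mem_nhds ustar hr))).and_eventually hev).exists
  have h1 := hn hball
  have h2 := h.J_le_of_mapClusterPt hη hcl (n + 1)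
  linarith

/-- If the radii stay away from zero, then only finitely many steps are rejected. -/
theorem eventually_accepts (h : P.IsSCPRun η u ε du) {δ : ℝ} (hδ : 0 < δ) (hε : ∀ n, δ ≤ ε n) :
    ∀ᶠ n in atTop, P.Accepts η (u n) (du n) := by
  have hbdd : BddBelow (Set.range ε) := ⟨δ, Set.forall_mem_range.2 hε⟩
  have hlim := tendsto_atTop_ciInf h.radius_antitone hbdd
  have hL : 0 < ⨅ n, ε n := hδ.trans_le (le_ciInf hε)
  filter_upwards [hlim.eventually_lt_const (by linarith : ⨅ n, ε n < 2 * ⨅ n, ε n)] with n hn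
  by_contra hrej
  have h1 := ciInf_le hbdd (n + 1)
  rw [(h.reject n hrej).2] at h1
  linarith

/-- Accumulation points of the controls under sufficient decrease are stationary. Near a
non-stationary accumulation point each accepted step lowers the cost in proportion to the radius.
If the radii stay away from zero, this is impossible for infinitely many steps. Otherwise all steps
near the point are eventually accepted, and each lowers the cost in proportion to its length; as the
cost converges, the iterates can no longer leave the neighbourhood, so that the radius is constant
from then on, which is the first case again. -/
theorem isKKT_of_mapClusterPt (h : P.IsSCPRun η u ε du) (hη0 : 0 ≤ η) (hη1 : η < 1)
    {ustar : Fin H → Fin m → ℝ} (hcl : MapClusterPt ustar atTop u)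
    (hdec : P.SufficientDecreaseAt η u du ustar) : P.IsKKT (P.rollout ustar) ustar := by
  have hadm : P.Admissible ustar :=
    P.isClosed_admissible.mem_of_mapClusterPt hcl (Eventually.of_forall h.admissible)
  by_contra hK
  obtain ⟨dv, hdv, hp⟩ := P.exists_pred_pos_of_not_isKKT hadm hK
  obtain ⟨c, hc, hpred⟩ := P.exists_eventually_mul_min_le_pred hdv hp
  obtain ⟨ε₁, hε₁, herr⟩ := P.exists_eventually_model_error_lt hdv hp (sub_pos.2 hη1)
  obtain ⟨κ, hκ, N, hN, hdec⟩ := hdec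
  obtain ⟨r, hr, hball⟩ := Metric.eventually_nhds_iff_ball.1 ((hpred.and herr).and hN)
  have hstep : ∀ᶠ n in atTop, u n ∈ Metric.ball ustar r → P.Accepts η (u n) (du n) →
      κ * (c * min 1 (ε n)) ≤ P.J (u n) - P.J (u (n + 1)) := by
    filter_upwards [hdec] with n hn hun hacc
    rw [(h.accept n hacc).1]
    refine le_trans ?_ (hn (hball _ hun).2 hacc)
    exact mul_le_mul_of_nonneg_left
      ((hball _ hun).1.1 (h.admissible n) _ (h.radius_pos n) _ (h.solves n)) hκ.le
  by_cases hsmall : ∃ n, ε n ≤ min 1 ε₁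
  · obtain ⟨n₀, hn₀⟩ := hsmall
    have hball_step : ∀ᶠ n in atTop, u n ∈ Metric.ball ustar r →
        P.Accepts η (u n) (du n) ∧ κ * c * ε n ≤ P.J (u n) - P.J (u (n + 1)) := by
      filter_upwards [hstep, eventually_ge_atTop n₀] with n hn hge hun
      have hεn : ε n ≤ min 1 ε₁ := (h.radius_antitone hge).trans hn₀
      have hacc := P.accepts_of_model_error_le ((hball _ hun).1.2 (h.admissible n) _
        (h.radius_pos n) (hεn.trans (min_le_right _ _)) _ (h.solves n)).le
      have := hn hun hacc
      rw [min_eq_right (hεn.trans (min_le_left _ _)), ← mul_assoc] at this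
      exact ⟨hacc, this⟩
    obtain ⟨n₁, hn₁⟩ := eventually_atTop.1 hball_step
    have hκc : 0 < κ * c := mul_pos hκ hc
    -- leaving the ball of radius `r` from inside the ball of radius `r / 2` costs `κ * c * (r / 2)`
    obtain ⟨n, ⟨hJn, hnr⟩, hge⟩ := ((hcl.frequently
      ((P.continuous_J.continuousAt.eventually_lt_const (lt_add_of_pos_right (P.J ustar)
        (by positivity : 0 < κ * c * (r / 2)))).and
        (Metric.ball_mem_nhds ustar (half_pos hr)))).and_eventually
          (eventually_ge_atTop n₁)).exists
    have hstay : ∀ l, u (n + l) ∈ Metric.ball ustar r ∧ ε (n + l) = ε n ∧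
        κ * c * dist (u (n + l)) (u n) ≤ P.J (u n) - P.J (u (n + l)) := by
      intro l
      induction l with
      | zero => simpa using hnr.trans (half_lt_self hr)
      | succ l ih =>
        obtain ⟨hin, hεl, hdist⟩ := ih
        obtain ⟨hacc, hdecl⟩ := hn₁ (n + l) (by omega) hin
        obtain ⟨hu, hε⟩ := h.accept _ hacc
        have hlen : dist (u (n + l + 1)) (u (n + l)) ≤ ε (n + l) := by
          rw [hu, dist_eq_norm, add_sub_cancel_left]
          exact ((P.mem_subFeasible_iff (h.radius_pos _).le).1 (h.solves _).1).2
        have hdist' : κ * c * dist (u (n + l + 1)) (u n) ≤ P.J (u n) - P.J (u (n + l + 1)) := by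
          have h1 := mul_le_mul_of_nonneg_left
            (dist_triangle (u (n + l + 1)) (u (n + l)) (u n)) hκc.le
          have h2 := mul_le_mul_of_nonneg_left hlen hκc.le
          linarith
        refine ⟨?_, hε.trans hεl, hdist'⟩
        have h1 := h.J_le_of_mapClusterPt hη0 hcl (n + l + 1)
        have h2 : dist (u (n + l + 1)) (u n) < r / 2 :=
          lt_of_mul_lt_mul_left (by linarith) hκc.le
        rw [Metric.mem_ball, ← add_assoc]
        linarith [dist_triangle (u (n + l + 1)) (u n) ustar]
    refine h.not_eventually_decrease hη0 hcl hr (mul_pos hκc (h.radius_pos n)) ?_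
    filter_upwards [eventually_ge_atTop n] with k hk hkr
    obtain ⟨l, rfl⟩ := Nat.exists_eq_add_of_le hk
    rw [← (hstay l).2.1]
    exact (hn₁ _ (by omega) hkr).2
  · push Not at hsmall
    have hδ : 0 < min 1 ε₁ := lt_min one_pos hε₁
    refine h.not_eventually_decrease hη0 hcl hr (mul_pos hκ (mul_pos hc hδ)) ?_
    filter_upwards [hstep, h.eventually_accepts hδ fun n => (hsmall n).le] with n hn hacc hun
    refine le_trans ?_ (hn hun hacc)
    have := le_min (min_le_left 1 ε₁) (hsmall n).le
    gcongr κ * (c * ?_)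

theorem sufficientDecreaseAt (hη : 0 < η) (ustar : Fin H → Fin m → ℝ) :
    P.SufficientDecreaseAt η u du ustar :=
  ⟨η, hη, Set.univ, univ_mem, Eventually.of_forall fun _ _ hacc => hacc⟩

end IsSCPRun

theorem eq_rollout_of_mapClusterPt {u : ℕ → Fin H → Fin m → ℝ} {zstar : Fin (H + 1) → Fin d → ℝ}
    {ustar : Fin H → Fin m → ℝ}
    (hcl : MapClusterPt (zstar, ustar) atTop fun n => (P.rollout (u n), u n)) :
    zstar = P.rollout ustar := by
  have hclosed : IsClosed {p : (Fin (H + 1) → Fin d → ℝ) × (Fin H → Fin m → ℝ) |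
      p.1 = P.rollout p.2} :=
    isClosed_eq continuous_fst ((P.contDiff_rollout (n := 0)).continuous.comp continuous_snd)
  exact hclosed.mem_of_mapClusterPt hcl (Eventually.of_forall fun _ => rfl)

end BilinearMPC


theorem proposition3p3 {d m H : ℕ} (P : BilinearMPC d m H) :
    -- the linearized and true costs differ by `O(ε²)`, uniformly on bounded sets
    (∀ S : Set (Fin H → Fin m → ℝ), Bornology.IsBounded S → ∀ εmax : ℝ, ∃ C : ℝ,
      ∀ ubar ∈ S, ∀ ε : ℝ, 0 < ε → ε ≤ εmax → ∀ du : Fin H → Fin m → ℝ, (∀ k, ‖du k‖ ≤ ε) →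
        |P.Jlin ubar du - P.J (ubar + du)| ≤ C * ε ^ 2) ∧
    -- the subproblems at admissible controls are solvable
    (∀ ubar : Fin H → Fin m → ℝ, P.Admissible ubar → ∀ ε : ℝ, 0 < ε →
      ∃ du, P.IsSubSolution ubar ε du) ∧
    -- a step whose model error is below the predicted decrease is a descent step
    (∀ (ubar : Fin H → Fin m → ℝ) (ε : ℝ) (du : Fin H → Fin m → ℝ),
      P.IsSubSolution ubar ε du → |P.Jlin ubar du - P.J (ubar + du)| < P.pred ubar du →
        P.J (ubar + du) < P.J ubar) ∧
    -- this holds for all small radii as soon as some predicted decrease is positive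
    (∀ ubar : Fin H → Fin m → ℝ, P.Admissible ubar →
      (∃ (ε : ℝ) (du : Fin H → Fin m → ℝ),
        0 < ε ∧ P.IsSubSolution ubar ε du ∧ 0 < P.pred ubar du) →
      ∃ ε₁ : ℝ, 0 < ε₁ ∧ ∀ ε : ℝ, 0 < ε → ε ≤ ε₁ → ∀ du, P.IsSubSolution ubar ε du →
        |P.Jlin ubar du - P.J (ubar + du)| < P.pred ubar du) ∧
    -- the predicted decrease vanishes exactly at the KKT points
    (∀ ubar : Fin H → Fin m → ℝ, P.Admissible ubar → ∀ ε : ℝ, 0 < ε → ∀ du,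
      P.IsSubSolution ubar ε du → (P.pred ubar du = 0 ↔ P.IsKKT (P.rollout ubar) ubar)) ∧
    -- runs of the algorithm
    (∀ η : ℝ, 0 ≤ η → η < 1 →
      ∀ (u : ℕ → Fin H → Fin m → ℝ) (ε : ℕ → ℝ) (du : ℕ → Fin H → Fin m → ℝ),
      P.IsSCPRun η u ε du →
        -- after finitely many halvings a step is accepted
        (∀ n, 0 < P.pred (u n) (du n) →
          ∃ l, (∀ i < l, ¬ P.Accepts η (u (n + i)) (du (n + i))) ∧
            P.Accepts η (u (n + l)) (du (n + l))) ∧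
        -- the cost is non-increasing
        Antitone (fun n => P.J (u n)) ∧
        -- accumulation points are KKT points
        (∀ (zstar : Fin (H + 1) → Fin d → ℝ) (ustar : Fin H → Fin m → ℝ),
          MapClusterPt (zstar, ustar) atTop (fun n => (P.rollout (u n), u n)) →
          (0 < η ∨ P.SufficientDecreaseAt η u du ustar) →
          P.IsKKT zstar ustar)) := by
  refine ⟨fun S hS εmax => ?_, fun ubar hu ε hε => P.exists_isSubSolution hu hε,
    fun ubar ε du _ herr => ?_, ?_, fun ubar hu ε hε du hdu =>
      (hdu.pred_eq_zero_iff hu hε).trans (P.isKKT_rollout_iff hu hε).symm,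
    fun η hη0 hη1 u ε du hrun => ⟨fun n hp => ?_, hrun.J_antitone hη0, ?_⟩⟩
  · obtain ⟨R, hR⟩ := hS.exists_norm_le
    obtain ⟨C, hC0, hC⟩ := P.exists_model_error_bound (max R εmax)
    refine ⟨C, fun ubar hu ε hε hεmax du hdu => ?_⟩
    have hdu' : ‖du‖ ≤ ε := (pi_norm_le_iff_of_nonneg hε.le).2 hdu
    refine (hC ubar du ((hR _ hu).trans (le_max_left _ _))
      ((hdu'.trans hεmax).trans (le_max_right _ _))).trans ?_
    gcongr
  · have h1 := neg_lt_of_abs_lt herr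
    rw [BilinearMPC.pred, P.Jlin_zero] at h1
    linarith
  · rintro ubar hu ⟨ε, dv, hε, hdv, hp⟩
    obtain ⟨ε₁, hε₁, hev⟩ := P.exists_eventually_model_error_lt hdv.1.1 hp one_pos
    refine ⟨ε₁, hε₁, fun ε' hε' hle du hdu => ?_⟩
    simpa using hev.self_of_nhds hu ε' hε' hle du hdu
  · classical
    have hex := hrun.exists_accepts hη1 hp
    exact ⟨Nat.find hex, fun i hi => Nat.find_min hex hi, Nat.find_spec hex⟩
  · intro zstar ustar hcl hdec
    rw [P.eq_rollout_of_mapClusterPt hcl]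
    exact hrun.isKKT_of_mapClusterPt hη0 hη1 (hcl.continuousAt_comp continuous_snd.continuousAt)
      (hdec.elim (fun hη => BilinearMPC.IsSCPRun.sufficientDecreaseAt hη ustar) id)
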